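/- Consider the linear system $x_{k+1}=Ax_k+Bu_k$, $y_k=Cx_k+Du_k$ with $x_k\in\mathbb R^n$, $u_k\in\mathbb R^m$, $y_k\in\mathbb R^p$, where $(A,B)$ is controllable and $(A,C)$ is observable. Let $\{u_k^{\rm d},y_k^{\rm d}\}_{k=0}^{N-1}$ be an input-output trajectory of this system (noise-free data). For a sequence $w_0,\dots,w_{N-1}$ in $\mathbb R^q$ let $H_l(w)$ be the block Hankel matrix with $l$ block rows and $N-l+1$ columns whose block $(i,j)$ is $w_{i+j}$ ($0\le i\le l-1$, $0\le j\le N-l$); $w$ is persistently exciting of order $l$ if $\operatorname{rank}H_l(w)=ql$. Let $L\ge\max\{n,1\}$, let $R\in\mathbb R^{m\times m}$, $Q\in\mathbb R^{p\times p}$ be symmetric positive definite, and let $\mathbb U\subseteq\mathbb R^m$, $\mathbb Y\subseteq\mathbb R^p$ be closed. Write $\|v\|_P^2=v^\top Pv$. For an extended state $\xi=(u_{-n},\dots,u_{-1},y_{-n},\dots,y_{-1})\in\mathbb R^{(m+p)n}$ consider the problem of minimizing $$\sum_{k=0}^{L-1}\|\bar u_k\|_R^2+\|\bar y_k\|_Q^2$$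 over $\alpha\in\mathbb R^{N-L-n+1}$, $\bar u=(\bar u_k)_{k=-n}^{L-1}$, $\bar y=(\bar y_k)_{k=-n}^{L-1}$ subject to $$\begin{bmatrix}\bar u\\ \bar y\end{bmatrix}=\begin{bmatrix}H_{L+n}(u^{\rm d})\\ H_{L+n}(y^{\rm d})\end{bmatrix}\alpha,\qquad (\bar u_k,\bar y_k)=(u_k,y_k)\ (-n\le k\le -1),$$ $$\bar u_k\in\mathbb U,\ \bar y_k\in\mathbb Y\ (0\le k\le L-1),\qquad \bar u_k=0,\ \bar y_k=0\ (L-n\le k\le L-1),$$ and let $J_L^*(\xi)$ be its optimal cost. In closed loop, the system runs from time $-n$ on, with arbitrary initial state and arbitrary inputs at the times $-n,\dots,-1$. At each time $t\in\mathbb Z_{\ge0}$ the problem is solved for $\xi=\xi_t:=(u_{t-n},\dots,u_{t-1},y_{t-n},\dots,y_{t-1})$, and the first element of an optimal input is applied: $u_t=\bar u_0^*(t)$ (any optimal solution may be chosen; if there is none, $u_t$ is arbitrary). Suppose that $u^{\rm d}$ is persistently exciting of order $L+2n$ and that there is $c_{\rm u}>0$ with $J_L^*(\xi)\le c_{\rm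 u}\|\xi\|_2^2$ for every $\xi$ for which the problem is feasible. If the problem is feasible at time $t=0$ (that is, for $\xi_0$), then: (i) it is feasible, and has an optimal solution, at every $t\in\mathbb Z_{\ge0}$; (ii) the closed loop satisfies $u_t\in\mathbb U$ and $y_t\in\mathbb Y$ for all $t\in\mathbb Z_{\ge0}$; (iii) the origin $\xi=0$ is exponentially stable for the closed loop, with the set of feasible extended states as region of attraction: the problem is feasible for $\xi=0$, and there are constants $M>0$ and $\rho\in(0,1)$, which do not depend on the closed-loop trajectory, such that $\|\xi_t\|_2\le M\rho^t\|\xi_0\|_2$ for all $t\in\mathbb Z_{\ge0}$ and all closed-loop trajectories for which the problem is feasible at time $t=0$ (in particular $\xi_0=0$ implies $\xi_t=0$ for all $t$). -/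

import Mathlib

open scoped Matrix

namespace DDMPC

/-- The block Hankel matrix of order `l` of a finite sequence `w_0, …, w_{N-1}` of vectors in
`ℝ^q`. Its block `(i, j)` is `w_{i+j}`; it has `l` block rows and `N - l + 1` columns
(none at all if `N < l`). -/
def hankel {N q : ℕ} (l : ℕ) (w : Fin N → Fin q → ℝ) :
    Matrix (Fin l × Fin q) (Fin (N + 1 - l)) ℝ :=
  Matrix.of fun i j => w ⟨i.1.val + j.val, by omega⟩ i.2

/-- A sequence `w_0, …, w_{N-1}` in `ℝ^q` is persistently exciting of order `l` if
`rank (H_l(w)) = q l`. -/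
def PersistentlyExciting {N q : ℕ} (l : ℕ) (w : Fin N → Fin q → ℝ) : Prop :=
  (hankel l w).rank = q * l

/-- The matrices of the linear system `x_{k+1} = A x_k + B u_k`, `y_k = C x_k + D u_k` with
state in `ℝ^n`, input in `ℝ^m` and output in `ℝ^p`. -/
structure LTISystem (n m p : ℕ) where
  A : Matrix (Fin n) (Fin n) ℝ
  B : Matrix (Fin n) (Fin m) ℝ
  C : Matrix (Fin p) (Fin n) ℝ
  D : Matrix (Fin p) (Fin m) ℝ

namespace LTISystem

variable {n m p : ℕ} (S : LTISystem n m p)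

/-- `(A, B)` is controllable: `[B, AB, …, A^{n-1}B]` has rank `n`. -/
def Controllable : Prop :=
  (Matrix.of fun (a : Fin n) (j : Fin n × Fin m) =>
    (S.A ^ j.1.val * S.B) a j.2).rank = n

/-- `(A, C)` is observable: the matrix with block rows `C, CA, …, CA^{n-1}` has rank `n`. -/
def Observable : Prop :=
  (Matrix.of fun (i : Fin n × Fin p) (b : Fin n) =>
    (S.C * S.A ^ i.1.val) i.2 b).rank = n

/-- `(x, u, y)` satisfies the system equations at time `k`. -/
def StepAt (x : ℤ → Fin n → ℝ) (u : ℤ → Fin m → ℝ) (y : ℤ → Fin p → ℝ) (k : ℤ) : Prop :=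
  x (k + 1) = S.A *ᵥ x k + S.B *ᵥ u k ∧ y k = S.C *ᵥ x k + S.D *ᵥ u k

/-- The finite sequence `(u_k, y_k)`, `0 ≤ k ≤ N - 1`, is an input-output trajectory of the
system, from some initial state. -/
def IsIOTrajectory {N : ℕ} (u : Fin N → Fin m → ℝ) (y : Fin N → Fin p → ℝ) : Prop :=
  ∃ x : ℕ → Fin n → ℝ, ∀ k : Fin N,
    x (k.val + 1) = S.A *ᵥ x k.val + S.B *ᵥ u k ∧ y k = S.C *ᵥ x k.val + S.D *ᵥ u k

end LTISystem

/-- The space `ℝ^{(m+p)n}` of extended states, with the Euclidean norm. -/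
abbrev ExtState (n m p : ℕ) : Type :=
  EuclideanSpace ℝ ((Fin n × Fin m) ⊕ (Fin n × Fin p))

/-- The extended state `ξ_t`, which stacks `u_{t-n}, …, u_{t-1}` and `y_{t-n}, …, y_{t-1}`. -/
def extState {m p : ℕ} (n : ℕ) (u : ℤ → Fin m → ℝ) (y : ℤ → Fin p → ℝ) (t : ℤ) :
    ExtState n m p :=
  WithLp.toLp 2 (Sum.elim
    (fun i => u (t - (n : ℤ) + (i.1.val : ℤ)) i.2)
    (fun i => y (t - (n : ℤ) + (i.1.val : ℤ)) i.2))

/-- The ingredients of the optimal control problem with horizon `L`: the data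
`(u^d_k, y^d_k)`, `0 ≤ k ≤ N - 1`, the weights `R`, `Q` and the constraint sets. -/
structure Problem (m p N : ℕ) where
  ud : Fin N → Fin m → ℝ
  yd : Fin N → Fin p → ℝ
  R : Matrix (Fin m) (Fin m) ℝ
  Q : Matrix (Fin p) (Fin p) ℝ
  U : Set (Fin m → ℝ)
  Y : Set (Fin p → ℝ)

/-- The decision variables `α`, `ū`, `ȳ`. The sequences `ū`, `ȳ` run over the times
`-n, …, L - 1`; time `k` is stored at position `n + k`. -/
structure Candidate (n m p N L : ℕ) where
  α : Fin (N + 1 - (n + L)) → ℝ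
  ubar : Fin (n + L) → Fin m → ℝ
  ybar : Fin (n + L) → Fin p → ℝ

namespace Candidate

variable {n m p N L : ℕ} (z : Candidate n m p N L)

/-- `ū_{-n}, …, ū_{-1}`. -/
def uPast (i : Fin n) : Fin m → ℝ := z.ubar (Fin.castAdd L i)

/-- `ȳ_{-n}, …, ȳ_{-1}`. -/
def yPast (i : Fin n) : Fin p → ℝ := z.ybar (Fin.castAdd L i)

/-- `ū_0, …, ū_{L-1}`. -/
def uPred (k : Fin L) : Fin m → ℝ := z.ubar (Fin.natAdd n k)

/-- `ȳ_0, …, ȳ_{L-1}`. -/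
def yPred (k : Fin L) : Fin p → ℝ := z.ybar (Fin.natAdd n k)

end Candidate

namespace Problem

variable {n m p N L : ℕ} (P : Problem m p N)

/-- The cost `∑_{k=0}^{L-1} ‖ū_k‖_R^2 + ‖ȳ_k‖_Q^2`. -/
def cost (z : Candidate n m p N L) : ℝ :=
  ∑ k : Fin L, (z.uPred k ⬝ᵥ (P.R *ᵥ z.uPred k) + z.yPred k ⬝ᵥ (P.Q *ᵥ z.yPred k))

/-- The constraints of the optimal control problem for the extended state `ξ`. -/
structure IsFeasible (ξ : ExtState n m p) (z : Candidate n m p N L) : Prop where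
  hankel_u : ∀ i : Fin (n + L) × Fin m, z.ubar i.1 i.2 = (hankel (n + L) P.ud *ᵥ z.α) i
  hankel_y : ∀ i : Fin (n + L) × Fin p, z.ybar i.1 i.2 = (hankel (n + L) P.yd *ᵥ z.α) i
  init_u : ∀ (i : Fin n) (a : Fin m), z.uPast i a = ξ (Sum.inl (i, a))
  init_y : ∀ (i : Fin n) (b : Fin p), z.yPast i b = ξ (Sum.inr (i, b))
  mem_U : ∀ k : Fin L, z.uPred k ∈ P.U
  mem_Y : ∀ k : Fin L, z.yPred k ∈ P.Y
  terminal_u : ∀ k : Fin L, L ≤ k.val + n → z.uPred k = 0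
  terminal_y : ∀ k : Fin L, L ≤ k.val + n → z.yPred k = 0

/-- The optimal control problem with horizon `L` is feasible for the extended state `ξ`. -/
def Feasible (L : ℕ) (ξ : ExtState n m p) : Prop :=
  ∃ z : Candidate n m p N L, P.IsFeasible ξ z

/-- `z` is an optimal solution of the optimal control problem for the extended state `ξ`. -/
def IsOptimal (ξ : ExtState n m p) (z : Candidate n m p N L) : Prop :=
  P.IsFeasible ξ z ∧ ∀ z' : Candidate n m p N L, P.IsFeasible ξ z' → P.cost z ≤ P.cost z'

/-- The optimal cost `J_L^*(ξ)` (meaningful when the problem is feasible for `ξ`). -/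
noncomputable def optCost (L : ℕ) (ξ : ExtState n m p) : ℝ :=
  sInf {c : ℝ | ∃ z : Candidate n m p N L, P.IsFeasible ξ z ∧ P.cost z = c}

end Problem

/-- `(x, u, y)` is a closed-loop trajectory: it satisfies the system equations from time `-n` on
(the times `-n, …, -1` provide the initial condition `ξ_0`), and at each time `t ≥ 0` at which
the optimal control problem has an optimal solution, the applied input `u_t` is the first
predicted input `ū_0^*(t)` of such a solution. If there is no optimal solution at time `t`, then
the scheme breaks down and nothing is required of `u_t`. -/
structure IsClosedLoop {n m p N L : ℕ} (S : LTISystem n m p) (P : Problem m p N) (hL : 0 < L)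
    (x : ℤ → Fin n → ℝ) (u : ℤ → Fin m → ℝ) (y : ℤ → Fin p → ℝ) : Prop where
  system : ∀ k : ℤ, -(n : ℤ) ≤ k → S.StepAt x u y k
  control : ∀ t : ℕ,
    (∃ z : Candidate n m p N L, P.IsOptimal (extState n u y t) z) →
    ∃ z : Candidate n m p N L, P.IsOptimal (extState n u y t) z ∧ u t = z.uPred ⟨0, hL⟩

end DDMPC

/-! Persistency of excitation makes the image of the data Hankel matrices exactly the set of system
trajectories of length `n + L` (`fundamental_lemma` and `LTISystem.IsIOTrajectory.hankel_mulVec`),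
so the problem is model-based predictive control with a terminal equality constraint. By
observability, `n` past samples fix the current state and the `n` terminal zeros force the predicted
state to end at the origin. Dropping the first sample and appending a zero one therefore gives a
feasible candidate at the next time, with cost lower by exactly the applied stage cost
(`Problem.IsFeasible.shift`).

Thus the optimal cost `J` decreases by at least a multiple of `‖u_t‖² + ‖y_t‖²`. This controls only
the newest sample, not all of `ξ_t`, so `J` alone need not contract. Adding a small multiple of an
age-weighted sum of the last `n` samples, which loses `‖ξ_t‖²` at each step, gives a Lyapunov
function that contracts geometrically (`exists_exponential_decay`). -/

namespace DDMPC

/-! ### Full rank, surjectivity and trivial kernels -/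

section LinearAlgebra

variable {ι κ : Type*} [Fintype ι] [Fintype κ]

theorem mulVec_surjective_of_rank_eq_card {M : Matrix ι κ ℝ} (h : M.rank = Fintype.card ι) :
    Function.Surjective M.mulVec := by
  have htop : LinearMap.range M.mulVecLin = ⊤ :=
    Submodule.eq_top_of_finrank_eq (by rw [Module.finrank_fintype_fun_eq_card]; exact h)
  exact LinearMap.range_eq_top.1 htop

theorem eq_zero_of_vecMul_eq_zero {M : Matrix ι κ ℝ} (h : M.rank = Fintype.card ι) {w : ι → ℝ}
    (hw : w ᵥ* M = 0) : w = 0 := by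
  obtain ⟨v, hv⟩ := mulVec_surjective_of_rank_eq_card h w
  have : w ⬝ᵥ w = 0 := by
    conv_lhs => rw [← hv]
    rw [hv, ← hv, Matrix.dotProduct_mulVec, hv, hw, zero_dotProduct]
  exact dotProduct_self_eq_zero.1 this

theorem eq_zero_of_mulVec_eq_zero {M : Matrix ι κ ℝ} (h : M.rank = Fintype.card κ) {v : κ → ℝ}
    (hv : M *ᵥ v = 0) : v = 0 :=
  eq_zero_of_vecMul_eq_zero (M := Mᵀ) (by rw [Matrix.rank_transpose, h])
    (by rw [Matrix.vecMul_transpose, hv])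

theorem mulVec_surjective_of_vecMul {M : Matrix ι κ ℝ}
    (h : ∀ w : ι → ℝ, w ᵥ* M = 0 → w = 0) : Function.Surjective M.mulVec := by
  apply mulVec_surjective_of_rank_eq_card
  apply LinearIndependent.rank_matrix
  rw [← Matrix.vecMul_injective_iff]
  intro a b hab
  refine sub_eq_zero.1 (h _ ?_)
  rw [Matrix.sub_vecMul]
  exact sub_eq_zero.2 hab

end LinearAlgebra

/-! ### Controllability, observability and the left kernel of the data matrix -/

namespace LTISystem

variable {n m p : ℕ} (S : LTISystem n m p)

theorem Controllable.eq_zero {S : LTISystem n m p} (h : S.Controllable) {ξ : Fin n → ℝ}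
    (hξ : ∀ k < n, ξ ᵥ* S.A ^ k ᵥ* S.B = 0) : ξ = 0 := by
  refine eq_zero_of_vecMul_eq_zero (by rw [Fintype.card_fin]; exact h) ?_
  funext j
  have := congrFun (hξ j.1 j.1.2) j.2
  rw [Matrix.vecMul_vecMul] at this
  exact this

theorem Observable.eq_zero {S : LTISystem n m p} (h : S.Observable) {x : Fin n → ℝ}
    (hx : ∀ k < n, S.C *ᵥ (S.A ^ k *ᵥ x) = 0) : x = 0 := by
  refine eq_zero_of_mulVec_eq_zero (by rw [Fintype.card_fin]; exact h) ?_
  funext j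
  have := congrFun (hx j.1 j.1.2) j.2
  rw [Matrix.mulVec_mulVec] at this
  exact this

/-- Coefficients of the functional on inputs obtained from `∑ i, η i ⬝ᵥ u i + ξ ⬝ᵥ x` by
advancing time `k` times. -/
def advance (η : ℕ → Fin m → ℝ) (ξ : Fin n → ℝ) : ℕ → ℕ → Fin m → ℝ
  | 0, i => η i
  | k + 1, 0 => ξ ᵥ* S.A ^ k ᵥ* S.B
  | k + 1, i + 1 => advance η ξ k i

theorem advance_add_right (η : ℕ → Fin m → ℝ) (ξ : Fin n → ℝ) (k i : ℕ) :
    S.advance η ξ k (i + k) = η i := by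
  induction k with
  | zero => rfl
  | succ k ih => exact ih

theorem advance_add_left (η : ℕ → Fin m → ℝ) (ξ : Fin n → ℝ) (k i : ℕ) :
    S.advance η ξ (k + 1 + i) i = ξ ᵥ* S.A ^ k ᵥ* S.B := by
  induction i with
  | zero => rfl
  | succ i ih => exact ih

/-- Each substitution of the state equation turns `ξ ⬝ᵥ x (j + 1)` into a term in `x j` and a term
in `u j`; the latter is the new front coefficient in `advance`. -/
theorem sum_advance {N T : ℕ} {x : ℕ → Fin n → ℝ} {u : ℕ → Fin m → ℝ}
    (hx : ∀ k < N, x (k + 1) = S.A *ᵥ x k + S.B *ᵥ u k) (η : ℕ → Fin m → ℝ) (ξ : Fin n → ℝ)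
    (k j : ℕ) (hjk : j + k ≤ N) :
    ∑ i ∈ Finset.range (T + k), S.advance η ξ k i ⬝ᵥ u (j + i) + (ξ ᵥ* S.A ^ k) ⬝ᵥ x j =
      ∑ i ∈ Finset.range T, η i ⬝ᵥ u (j + k + i) + ξ ⬝ᵥ x (j + k) := by
  induction k generalizing j with
  | zero => simp [advance]
  | succ k ih =>
    have h := ih (j + 1) (by omega)
    rw [show j + (k + 1) = j + 1 + k by omega, ← h, ← add_assoc, Finset.sum_range_succ',
      hx j (by omega)]
    simp only [advance, add_zero, dotProduct_add, Matrix.dotProduct_mulVec, Matrix.vecMul_vecMul,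
      pow_succ]
    have : ∀ i, u (j + (i + 1)) = u (j + 1 + i) := fun i => congrArg u (by omega)
    rw [Finset.sum_congr rfl fun i _ => by rw [this i]]
    ring

/-- Full row rank of the stacked input Hankel matrix and state matrix, as triviality of the left
kernel. -/
theorem Controllable.left_kernel {S : LTISystem n m p} (hc : S.Controllable) {N T : ℕ}
    {x : ℕ → Fin n → ℝ} {u : ℕ → Fin m → ℝ}
    (hx : ∀ k < N, x (k + 1) = S.A *ᵥ x k + S.B *ᵥ u k)
    (hpe : ∀ E : ℕ → Fin m → ℝ,
      (∀ j, j + (T + n) ≤ N → ∑ i ∈ Finset.range (T + n), E i ⬝ᵥ u (j + i) = 0) →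
      ∀ i < T + n, E i = 0)
    {η : ℕ → Fin m → ℝ} (hη : ∀ i, T ≤ i → η i = 0) {ξ : Fin n → ℝ}
    (h : ∀ j, j + T ≤ N → ∑ i ∈ Finset.range T, η i ⬝ᵥ u (j + i) + ξ ⬝ᵥ x j = 0) :
    η = 0 ∧ ξ = 0 := by
  set c := S.A.charpoly with hcdef
  have hdeg : c.natDegree = n := by simp [hcdef]
  have hlead : c.coeff n = 1 := by
    have := S.A.charpoly_monic
    rw [Polynomial.Monic, Polynomial.leadingCoeff] at this
    rwa [← hcdef, hdeg] at this
  have hCH : ∑ k ∈ Finset.range (n + 1), c.coeff k • S.A ^ k = 0 := by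
    have := S.A.aeval_self_charpoly
    rwa [Polynomial.aeval_eq_sum_range, ← hcdef, hdeg] at this
  -- Weighting the advanced relations by the coefficients of the characteristic polynomial cancels
  -- the state terms by Cayley–Hamilton. What remains annihilates every input window of length `T +
  -- n`, so excitation kills it.
  set E : ℕ → Fin m → ℝ := fun i => ∑ k ∈ Finset.range (n + 1), c.coeff k • S.advance η ξ k i
    with hE
  have hE0 : ∀ i < T + n, E i = 0 := by
    apply hpe
    intro j hj
    have hk : ∀ k ∈ Finset.range (n + 1), c.coeff k *
        (∑ i ∈ Finset.range (T + n), S.advance η ξ k i ⬝ᵥ u (j + i) +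
          (ξ ᵥ* S.A ^ k) ⬝ᵥ x j) = 0 := by
      intro k hk
      have hkn : k ≤ n := by simpa [Nat.lt_succ_iff] using hk
      have hsub : ∑ i ∈ Finset.range (T + n), S.advance η ξ k i ⬝ᵥ u (j + i) =
          ∑ i ∈ Finset.range (T + k), S.advance η ξ k i ⬝ᵥ u (j + i) := by
        symm
        apply Finset.sum_subset
        · intro i; simp only [Finset.mem_range]; omega
        · intro i _ hi
          have hi' : T + k ≤ i := by simpa using hi
          obtain ⟨r, rfl⟩ := Nat.exists_eq_add_of_le hi'
          rw [show T + k + r = T + r + k by omega, S.advance_add_right, hη _ (by omega),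
            zero_dotProduct]
      rw [hsub, S.sum_advance hx η ξ k j (by omega), h (j + k) (by omega), mul_zero]
    have hs := Finset.sum_eq_zero hk
    simp only [mul_add, Finset.sum_add_distrib] at hs
    have hx0 : ∑ k ∈ Finset.range (n + 1), c.coeff k * ((ξ ᵥ* S.A ^ k) ⬝ᵥ x j) = 0 := by
      have : (ξ ᵥ* (∑ k ∈ Finset.range (n + 1), c.coeff k • S.A ^ k)) ⬝ᵥ x j = 0 := by
        rw [hCH]; simp
      rw [Matrix.vecMul_sum, sum_dotProduct] at this
      simpa [Matrix.vecMul_smul] using this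
    rw [hx0, add_zero] at hs
    rw [← hs]
    simp only [Finset.mul_sum, hE, sum_dotProduct, smul_dotProduct, smul_eq_mul]
    exact Finset.sum_comm
  -- Downward induction from `T`: as the polynomial is monic, entry `i + n` of `E` is `η i` plus
  -- multiples of later entries of `η`.
  have hη0 : ∀ d i, T ≤ i + d → η i = 0 := by
    intro d
    induction d with
    | zero => exact hη
    | succ d ih =>
      intro i hi
      by_cases hiT : T ≤ i
      · exact hη i hiT
      have := hE0 (i + n) (by omega)
      simp only [hE] at this
      rw [Finset.sum_range_succ, S.advance_add_right, hlead, one_smul, Finset.sum_eq_zero,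
        zero_add] at this
      · exact this
      · intro k hk
        have hkn : k < n := by simpa using hk
        rw [show i + n = i + (n - k) + k by omega, S.advance_add_right, ih _ (by omega), smul_zero]
  have hη' : η = 0 := funext fun i => hη0 T i (by omega)
  refine ⟨hη', hc.eq_zero ?_⟩
  -- With `η = 0`, entry `n - 1 - k` of `E` is `ξ A^k B` plus multiples of `ξ A^j B` with `j < k`.
  intro k
  induction k using Nat.strong_induction_on with
  | _ k ih =>
    intro hk
    have := hE0 (n - 1 - k) (by omega)
    simp only [hE] at this
    rw [Finset.sum_range_succ, hlead, one_smul, Finset.sum_eq_zero, zero_add] at this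
    · rw [← this]
      have := S.advance_add_left η ξ k (n - 1 - k)
      rw [← this]
      congr 1
      omega
    · intro l hl
      have hln : l < n := by simpa using hl
      by_cases hlk : l ≤ n - 1 - k
      · have := S.advance_add_right η ξ l (n - 1 - k - l)
        rw [Nat.sub_add_cancel hlk] at this
        rw [this, hη', Pi.zero_apply, smul_zero]
      · have := S.advance_add_left η ξ (l - 1 - (n - 1 - k)) (n - 1 - k)
        rw [show l - 1 - (n - 1 - k) + 1 + (n - 1 - k) = l by omega] at this
        rw [this, ih _ (by omega) (by omega), smul_zero]

end LTISystem

/-! ### Trajectories as combinations of data windows -/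

/-- Willems' fundamental lemma. -/
theorem fundamental_lemma {n m p N T : ℕ} {S : LTISystem n m p} (hc : S.Controllable)
    {ud : Fin N → Fin m → ℝ} {yd : Fin N → Fin p → ℝ} (hdata : S.IsIOTrajectory ud yd)
    (hpe : PersistentlyExciting (T + n) ud) {u : Fin T → Fin m → ℝ} {y : Fin T → Fin p → ℝ}
    (h : S.IsIOTrajectory u y) :
    ∃ α : Fin (N + 1 - T) → ℝ, (∀ i, u i.1 i.2 = (hankel T ud *ᵥ α) i) ∧
      ∀ i, y i.1 i.2 = (hankel T yd *ᵥ α) i := by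
  obtain ⟨xd, hxd⟩ := hdata
  obtain ⟨x, hx⟩ := h
  let u' : ℕ → Fin m → ℝ := fun k => if h : k < N then ud ⟨k, h⟩ else 0
  have hu' : ∀ k (hk : k < N), u' k = ud ⟨k, hk⟩ := fun k hk => dif_pos hk
  have hxd' : ∀ k < N, xd (k + 1) = S.A *ᵥ xd k + S.B *ᵥ u' k := by
    intro k hk
    rw [hu' k hk]
    exact (hxd ⟨k, hk⟩).1
  let M : Matrix ((Fin T × Fin m) ⊕ Fin n) (Fin (N + 1 - T)) ℝ :=
    Matrix.of (Sum.elim (fun i => hankel T ud i) (fun a j => xd j.val a))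
  have hM : Function.Surjective M.mulVec := by
    apply mulVec_surjective_of_vecMul
    intro w hw
    let η : ℕ → Fin m → ℝ := fun i => if h : i < T then fun a => w (Sum.inl (⟨i, h⟩, a)) else 0
    let ξ : Fin n → ℝ := fun a => w (Sum.inr a)
    have key : η = 0 ∧ ξ = 0 := by
      refine hc.left_kernel (N := N) (T := T) hxd' ?_ (fun i hi => dif_neg (by omega)) ?_
      · intro E hE i hi
        have h0 : (fun i : Fin (T + n) × Fin m => E i.1.val i.2) = 0 := by
          refine eq_zero_of_vecMul_eq_zero (M := hankel (T + n) ud) ?_ ?_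
          · rw [hpe]; simp [mul_comm]
          · funext j
            have := hE j.val (by omega)
            rw [Finset.sum_range] at this
            rw [Pi.zero_apply, ← this]
            simp only [Matrix.vecMul, dotProduct, Fintype.sum_prod_type]
            refine Finset.sum_congr rfl fun i _ => Finset.sum_congr rfl fun a _ => ?_
            rw [hu' _ (by omega)]
            simp [hankel, add_comm]
        funext a
        exact congrFun h0 (⟨i, hi⟩, a)
      · intro j hj
        have := congrFun hw ⟨j, by omega⟩
        simp only [Matrix.vecMul, dotProduct, Fintype.sum_sum_type, Fintype.sum_prod_type,
          Pi.zero_apply] at this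
        rw [← this, Finset.sum_range]
        refine congrArg₂ _ ?_ rfl
        refine Finset.sum_congr rfl fun i _ => Finset.sum_congr rfl fun a _ => ?_
        rw [hu' _ (by omega)]
        simp [M, η, hankel, add_comm]
    funext s
    rcases s with ⟨i, a⟩ | a
    · have := congrFun (congrFun key.1 i.val) a
      simpa [η] using this
    · exact congrFun key.2 a
  -- Matching the initial state together with the inputs is what makes the same `α` reproduce the
  -- states, and hence the outputs.
  obtain ⟨α, hα⟩ := hM (Sum.elim (fun i => u i.1 i.2) (x 0))
  have hαu : ∀ i, u i.1 i.2 = (hankel T ud *ᵥ α) i := fun i => (congrFun hα (Sum.inl i)).symm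
  have hu : ∀ k (hk : k < T), u ⟨k, hk⟩ = ∑ j, α j • ud ⟨k + j.val, by omega⟩ := by
    intro k hk
    funext a
    rw [hαu (⟨k, hk⟩, a)]
    simp [Matrix.mulVec, dotProduct, hankel, mul_comm]
  have hstate : ∀ k ≤ T, x k = ∑ j, α j • xd (k + j.val) := by
    intro k
    induction k with
    | zero =>
      intro _
      funext a
      have := congrFun hα (Sum.inr a)
      simp only [Sum.elim_inr] at this
      rw [← this]
      simp [M, Matrix.mulVec, dotProduct, mul_comm]
    | succ k ih =>
      intro hk
      rw [(hx ⟨k, hk⟩).1, ih (by omega), hu k hk]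
      simp only [Matrix.mulVec_sum, Matrix.mulVec_smul, ← Finset.sum_add_distrib, ← smul_add]
      refine Finset.sum_congr rfl fun j _ => ?_
      rw [show k + 1 + j.val = k + j.val + 1 by omega]
      exact congrArg _ (hxd ⟨k + j.val, by omega⟩).1.symm
  refine ⟨α, hαu, ?_⟩
  rintro ⟨⟨k, hk⟩, b⟩
  have hy : y ⟨k, hk⟩ = ∑ j, α j • yd ⟨k + j.val, by omega⟩ := by
    rw [(hx ⟨k, hk⟩).2, hstate k hk.le, hu k hk]
    simp only [Matrix.mulVec_sum, Matrix.mulVec_smul, ← Finset.sum_add_distrib, ← smul_add]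
    refine Finset.sum_congr rfl fun j _ => ?_
    exact congrArg _ (hxd ⟨k + j.val, by omega⟩).2.symm
  simp only [hy]
  simp [Matrix.mulVec, dotProduct, hankel, mul_comm]

/-- By linearity and time invariance, the same combination of shifted data states is a state
sequence; neither excitation nor controllability is needed. -/
theorem LTISystem.IsIOTrajectory.hankel_mulVec {n m p N T : ℕ} {S : LTISystem n m p}
    {ud : Fin N → Fin m → ℝ} {yd : Fin N → Fin p → ℝ} (hdata : S.IsIOTrajectory ud yd)
    {u : Fin T → Fin m → ℝ} {y : Fin T → Fin p → ℝ} {α : Fin (N + 1 - T) → ℝ}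
    (hαu : ∀ i, u i.1 i.2 = (hankel T ud *ᵥ α) i)
    (hαy : ∀ i, y i.1 i.2 = (hankel T yd *ᵥ α) i) : S.IsIOTrajectory u y := by
  obtain ⟨xd, hxd⟩ := hdata
  have hu : ∀ k (hk : k < T), u ⟨k, hk⟩ = ∑ j, α j • ud ⟨k + j.val, by omega⟩ := by
    intro k hk
    funext a
    rw [hαu (⟨k, hk⟩, a)]
    simp [Matrix.mulVec, dotProduct, hankel, mul_comm]
  have hy : ∀ k (hk : k < T), y ⟨k, hk⟩ = ∑ j, α j • yd ⟨k + j.val, by omega⟩ := by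
    intro k hk
    funext a
    rw [hαy (⟨k, hk⟩, a)]
    simp [Matrix.mulVec, dotProduct, hankel, mul_comm]
  refine ⟨fun k => ∑ j, α j • xd (k + j.val), ?_⟩
  rintro ⟨k, hk⟩
  rw [hu k hk, hy k hk]
  simp only [Matrix.mulVec_sum, Matrix.mulVec_smul, ← Finset.sum_add_distrib, ← smul_add]
  refine ⟨Finset.sum_congr rfl fun j _ => ?_, Finset.sum_congr rfl fun j _ => ?_⟩
  · rw [show k + 1 + j.val = k + j.val + 1 by omega]
    exact congrArg _ (hxd ⟨k + j.val, by omega⟩).1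
  · exact congrArg _ (hxd ⟨k + j.val, by omega⟩).2

/-! ### Coercivity, state reconstruction and exponential decay -/

/-- The quadratic form attains a positive minimum on the compact Euclidean unit sphere, and
homogeneity extends the bound. The sphere is written with `⬝ᵥ` because the norm on `ι → ℝ` is the
sup norm. -/
theorem exists_coercive_of_posDef {ι : Type*} [Fintype ι] {R : Matrix ι ι ℝ} (hR : R.PosDef) :
    ∃ c : ℝ, 0 < c ∧ ∀ v : ι → ℝ, c * (v ⬝ᵥ v) ≤ v ⬝ᵥ (R *ᵥ v) := by
  have hpos : ∀ v : ι → ℝ, v ≠ 0 → 0 < v ⬝ᵥ (R *ᵥ v) := fun v hv => by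
    simpa using hR.dotProduct_mulVec_pos hv
  have hself : ∀ v : ι → ℝ, 0 ≤ v ⬝ᵥ v := fun v => Finset.sum_nonneg fun i _ => mul_self_nonneg _
  let K : Set (ι → ℝ) := {v | v ⬝ᵥ v = 1}
  have hK : IsCompact K := by
    refine Metric.isCompact_of_isClosed_isBounded
      (isClosed_eq (by unfold dotProduct; fun_prop) continuous_const) ?_
    refine Metric.isBounded_closedBall.subset (t := Metric.closedBall 0 1) ?_
    intro v hv
    rw [mem_closedBall_zero_iff, pi_norm_le_iff_of_nonneg zero_le_one]
    intro i
    rw [Real.norm_eq_abs, abs_le_one_iff_mul_self_le_one]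
    have hv' : ∑ j, v j * v j = 1 := hv
    rw [← hv']
    exact Finset.single_le_sum (f := fun j => v j * v j) (fun j _ => mul_self_nonneg _)
      (Finset.mem_univ i)
  have hscale : ∀ v : ι → ℝ, v ≠ 0 → ∃ w ∈ K, v ⬝ᵥ (R *ᵥ v) = (v ⬝ᵥ v) * (w ⬝ᵥ (R *ᵥ w)) := by
    intro v hv
    have hs : 0 < v ⬝ᵥ v :=
      lt_of_le_of_ne (hself v) fun h => hv (dotProduct_self_eq_zero.1 h.symm)
    obtain ⟨r, hr, hrs⟩ : ∃ r : ℝ, r ≠ 0 ∧ v ⬝ᵥ v = r * r :=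
      ⟨√(v ⬝ᵥ v), (Real.sqrt_pos.2 hs).ne', (Real.mul_self_sqrt hs.le).symm⟩
    refine ⟨r⁻¹ • v, ?_, ?_⟩
    · change _ ⬝ᵥ _ = _
      rw [smul_dotProduct, dotProduct_smul, smul_eq_mul, smul_eq_mul, hrs]
      field_simp
    · rw [Matrix.mulVec_smul, smul_dotProduct, dotProduct_smul, smul_eq_mul, smul_eq_mul, hrs]
      field_simp
  rcases K.eq_empty_or_nonempty with hKe | hKn
  · refine ⟨1, one_pos, fun v => ?_⟩
    by_cases hv : v = 0
    · simp [hv]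
    · obtain ⟨w, hw, -⟩ := hscale v hv
      rw [hKe] at hw
      exact hw.elim
  · obtain ⟨w, hw, hmin⟩ := hK.exists_isMinOn hKn
      (f := fun v => v ⬝ᵥ (R *ᵥ v))
      (by unfold dotProduct Matrix.mulVec dotProduct; fun_prop)
    have hw0 : w ≠ 0 := by
      rintro rfl
      simp [K] at hw
    refine ⟨_, hpos w hw0, fun v => ?_⟩
    by_cases hv : v = 0
    · simp [hv]
    · obtain ⟨w', hw', h⟩ := hscale v hv
      rw [h, mul_comm]
      exact mul_le_mul_of_nonneg_left (hmin hw') (hself v)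

/-- Two input-output equal system trajectories over `n` steps have equal states. -/
theorem LTISystem.Observable.state_eq {n m p : ℕ} {S : LTISystem n m p} (ho : S.Observable)
    {x x' : ℕ → Fin n → ℝ} {u u' : ℕ → Fin m → ℝ} {y y' : ℕ → Fin p → ℝ}
    (h : ∀ k < n, x (k + 1) = S.A *ᵥ x k + S.B *ᵥ u k ∧ y k = S.C *ᵥ x k + S.D *ᵥ u k)
    (h' : ∀ k < n, x' (k + 1) = S.A *ᵥ x' k + S.B *ᵥ u' k ∧ y' k = S.C *ᵥ x' k + S.D *ᵥ u' k)
    (hu : ∀ k < n, u k = u' k) (hy : ∀ k < n, y k = y' k) : x n = x' n := by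
  have hpow : ∀ k ≤ n, x k - x' k = S.A ^ k *ᵥ (x 0 - x' 0) := by
    intro k
    induction k with
    | zero => simp
    | succ k ih =>
      intro hk
      rw [(h k hk).1, (h' k hk).1, hu k hk, add_sub_add_right_eq_sub, ← Matrix.mulVec_sub,
        ih (by omega), Matrix.mulVec_mulVec, pow_succ']
  have h0 : x 0 - x' 0 = 0 := by
    refine ho.eq_zero fun k hk => ?_
    have := hy k hk
    rw [(h k hk).2, (h' k hk).2, hu k hk] at this
    rw [← hpow k hk.le, Matrix.mulVec_sub]
    exact sub_eq_zero.2 (add_right_cancel this)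
  have := hpow n le_rfl
  rw [h0, Matrix.mulVec_zero] at this
  exact sub_eq_zero.1 this

/-- Total weight of a window weighted by age: one step adds the newest term and removes the
whole window. -/
theorem sum_weighted_window (f : ℕ → ℝ) (n : ℕ) :
    ∑ i ∈ Finset.range n, ((i : ℝ) + 1) * f (i + 1) =
      ∑ i ∈ Finset.range n, ((i : ℝ) + 1) * f i + n * f n - ∑ i ∈ Finset.range n, f i := by
  induction n with
  | zero => simp
  | succ n ih =>
    rw [Finset.sum_range_succ, ih, Finset.sum_range_succ, Finset.sum_range_succ]
    push_cast
    ring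

/-- If a nonnegative `J` decreases by at least `c * l t` at time `t` and is bounded by the sum of
the last `n` values of `l`, then this sum decays exponentially. -/
theorem exists_exponential_decay (n : ℕ) {c cu : ℝ} (hc : 0 < c) (hcu : 0 < cu) :
    ∃ K θ : ℝ, 0 < K ∧ 0 < θ ∧ θ < 1 ∧ ∀ (l : ℤ → ℝ) (J : ℕ → ℝ), (∀ k, 0 ≤ l k) →
      (∀ t, 0 ≤ J t) → (∀ t : ℕ, J (t + 1) + c * l t ≤ J t) →
      (∀ t : ℕ, J t ≤ cu * ∑ i ∈ Finset.range n, l ((t : ℤ) - n + i)) →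
      ∀ t : ℕ, ∑ i ∈ Finset.range n, l ((t : ℤ) - n + i) ≤
        K * θ ^ t * ∑ i ∈ Finset.range n, l (((0 : ℕ) : ℤ) - n + i) := by
  have hn1 : (0 : ℝ) < n + 1 := by positivity
  -- The weighted window sum `W` grows by at most `n * l t` in a step, so this `ε` lets the decrease
  -- `c * l t` of `J` absorb `ε * n * l t`. Using `n + 1` covers `n = 0`.
  obtain ⟨ε, hε, hεc⟩ : ∃ ε : ℝ, 0 < ε ∧ ε * (n + 1) = c :=
    ⟨c / (n + 1), by positivity, by field_simp⟩
  -- The first two terms bound `J + ε W` by a multiple of the window sum; the extra `ε` ensures `ε <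
  -- K` even for `n = 0`.
  obtain ⟨K, hK⟩ : ∃ K : ℝ, K = cu + ε * n + ε := ⟨_, rfl⟩
  have hK0 : 0 < K := by rw [hK]; positivity
  have hεK : ε < K := by
    have : 0 ≤ ε * n := by positivity
    linarith
  refine ⟨K / ε, 1 - ε / K, by positivity, sub_pos.2 ((div_lt_one hK0).2 hεK),
    sub_lt_self _ (by positivity), ?_⟩
  intro l J hl hJ hdec hJub
  set g : ℕ → ℝ := fun t => ∑ i ∈ Finset.range n, l ((t : ℤ) - n + i) with hg
  set W : ℕ → ℝ := fun t => ∑ i ∈ Finset.range n, ((i : ℝ) + 1) * l ((t : ℤ) - n + i) with hW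
  have hg0 : ∀ t, 0 ≤ g t := fun t => Finset.sum_nonneg fun i _ => hl _
  have hgW : ∀ t, g t ≤ W t := fun t => Finset.sum_le_sum fun i _ => by
    have := mul_nonneg (Nat.cast_nonneg (α := ℝ) i) (hl ((t : ℤ) - n + i))
    linarith
  have hWg : ∀ t, W t ≤ n * g t := fun t => by
    rw [hg, hW, Finset.mul_sum]
    refine Finset.sum_le_sum fun i hi => mul_le_mul_of_nonneg_right ?_ (hl _)
    exact_mod_cast Finset.mem_range.1 hi
  have hWs : ∀ t : ℕ, W (t + 1) = W t + n * l t - g t := fun t => by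
    have := sum_weighted_window (fun i => l ((t : ℤ) - n + i)) n
    simp only [sub_add_cancel] at this
    rw [← this]
    refine Finset.sum_congr rfl fun i _ => ?_
    congr 2
    push_cast
    ring
  have hV : ∀ t, J t + ε * W t ≤ K * g t := fun t => by
    have h1 := mul_le_mul_of_nonneg_left (hWg t) hε.le
    have h2 := mul_nonneg hε.le (hg0 t)
    rw [hK]
    linarith [hJub t]
  -- One step lowers `J + ε W` by at least `ε * g t`, which `hV` bounds below by the fraction `ε /
  -- K` of its value.
  have hstep : ∀ t, J (t + 1) + ε * W (t + 1) ≤ (1 - ε / K) * (J t + ε * W t) := fun t => by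
    have h1 : ε / K * (J t + ε * W t) ≤ ε * g t := by
      have := mul_le_mul_of_nonneg_left (hV t) (div_nonneg hε.le hK0.le)
      rwa [← mul_assoc, div_mul_cancel₀ _ hK0.ne'] at this
    have h2 := mul_nonneg hε.le (hl t)
    have h3 := hdec t
    rw [← hεc] at h3
    rw [hWs]
    linarith
  have hθ : 0 ≤ 1 - ε / K := (sub_pos.2 ((div_lt_one hK0).2 hεK)).le
  have hpow : ∀ t, J t + ε * W t ≤ (1 - ε / K) ^ t * (J 0 + ε * W 0) := fun t => by
    induction t with
    | zero => simp
    | succ t ih =>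
      rw [pow_succ', mul_assoc]
      exact (hstep t).trans (mul_le_mul_of_nonneg_left ih hθ)
  intro t
  have h1 : ε * g t ≤ (1 - ε / K) ^ t * (K * g 0) :=
    calc ε * g t ≤ ε * W t := mul_le_mul_of_nonneg_left (hgW t) hε.le
      _ ≤ J t + ε * W t := le_add_of_nonneg_left (hJ t)
      _ ≤ _ := hpow t
      _ ≤ _ := mul_le_mul_of_nonneg_left (hV 0) (pow_nonneg hθ t)
  have h2 : K / ε * (1 - ε / K) ^ t * g 0 = (1 - ε / K) ^ t * (K * g 0) / ε := by ring
  change g t ≤ K / ε * (1 - ε / K) ^ t * g 0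
  rw [h2, le_div_iff₀ hε, mul_comm]
  exact h1

/-! ### Stage cost and existence of optimal solutions -/

namespace Problem

variable {n m p N L : ℕ} {P : Problem m p N}

/-- The stage cost `‖u‖_R^2 + ‖y‖_Q^2`. -/
def stage (P : Problem m p N) (u : Fin m → ℝ) (y : Fin p → ℝ) : ℝ :=
  u ⬝ᵥ (P.R *ᵥ u) + y ⬝ᵥ (P.Q *ᵥ y)

theorem stage_zero : P.stage 0 0 = 0 := by simp [stage]

theorem exists_le_stage (hR : P.R.PosDef) (hQ : P.Q.PosDef) :
    ∃ c : ℝ, 0 < c ∧ ∀ u y, c * (u ⬝ᵥ u + y ⬝ᵥ y) ≤ P.stage u y := by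
  obtain ⟨a, ha, hRa⟩ := exists_coercive_of_posDef hR
  obtain ⟨b, hb, hQb⟩ := exists_coercive_of_posDef hQ
  refine ⟨min a b, lt_min ha hb, fun u y => ?_⟩
  have hu : 0 ≤ u ⬝ᵥ u := Finset.sum_nonneg fun i _ => mul_self_nonneg _
  have hy : 0 ≤ y ⬝ᵥ y := Finset.sum_nonneg fun i _ => mul_self_nonneg _
  rw [mul_add]
  exact add_le_add ((mul_le_mul_of_nonneg_right (min_le_left a b) hu).trans (hRa u))
    ((mul_le_mul_of_nonneg_right (min_le_right a b) hy).trans (hQb y))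

theorem stage_nonneg (hR : P.R.PosDef) (hQ : P.Q.PosDef) (u : Fin m → ℝ) (y : Fin p → ℝ) :
    0 ≤ P.stage u y := by
  have h1 := hR.posSemidef.dotProduct_mulVec_nonneg u
  have h2 := hQ.posSemidef.dotProduct_mulVec_nonneg y
  simp only [star_trivial] at h1 h2
  exact add_nonneg h1 h2

theorem cost_eq (z : Candidate n m p N L) :
    P.cost z = ∑ k : Fin L, P.stage (z.uPred k) (z.yPred k) := rfl

theorem stage_le_cost (hR : P.R.PosDef) (hQ : P.Q.PosDef) (z : Candidate n m p N L) (k : Fin L) :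
    P.stage (z.uPred k) (z.yPred k) ≤ P.cost z :=
  Finset.single_le_sum (f := fun k => P.stage (z.uPred k) (z.yPred k))
    (fun _ _ => stage_nonneg hR hQ _ _) (Finset.mem_univ k)

theorem cost_nonneg (hR : P.R.PosDef) (hQ : P.Q.PosDef) (z : Candidate n m p N L) :
    0 ≤ P.cost z :=
  Finset.sum_nonneg fun _ _ => stage_nonneg hR hQ _ _

theorem IsOptimal.optCost_eq {ξ : ExtState n m p} {z : Candidate n m p N L}
    (hz : P.IsOptimal ξ z) : P.optCost L ξ = P.cost z := by
  refine IsLeast.csInf_eq ⟨⟨z, hz.1, rfl⟩, ?_⟩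
  rintro _ ⟨z', hz', rfl⟩
  exact hz.2 z' hz'

theorem norm_le_of_stage_le {c C : ℝ} (hc : 0 < c)
    (h : ∀ u y, c * (u ⬝ᵥ u + y ⬝ᵥ y) ≤ P.stage u y) {u : Fin m → ℝ} {y : Fin p → ℝ}
    (hC : P.stage u y ≤ C) : ‖u‖ ≤ √(C / c) ∧ ‖y‖ ≤ √(C / c) := by
  have hu : 0 ≤ u ⬝ᵥ u := Finset.sum_nonneg fun i _ => mul_self_nonneg _
  have hy : 0 ≤ y ⬝ᵥ y := Finset.sum_nonneg fun i _ => mul_self_nonneg _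
  have hle : u ⬝ᵥ u + y ⬝ᵥ y ≤ C / c := by
    rw [le_div_iff₀ hc, mul_comm]
    exact (h u y).trans hC
  refine ⟨(pi_norm_le_iff_of_nonneg (Real.sqrt_nonneg _)).2 fun i => ?_,
    (pi_norm_le_iff_of_nonneg (Real.sqrt_nonneg _)).2 fun i => ?_⟩
  · refine Real.abs_le_sqrt (le_trans ?_ (le_trans (le_add_of_nonneg_right hy) hle))
    rw [sq]
    exact Finset.single_le_sum (f := fun j => u j * u j) (fun j _ => mul_self_nonneg _)
      (Finset.mem_univ i)
  · refine Real.abs_le_sqrt (le_trans ?_ (le_trans (le_add_of_nonneg_left hu) hle))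
    rw [sq]
    exact Finset.single_le_sum (f := fun j => y j * y j) (fun j _ => mul_self_nonneg _)
      (Finset.mem_univ i)

/-- The predicted input-output sequences that satisfy the constraints for `ξ`. -/
def feasiblePredictions (P : Problem m p N) (L : ℕ) (ξ : ExtState n m p) :
    Set ((Fin (n + L) → Fin m → ℝ) × (Fin (n + L) → Fin p → ℝ)) :=
  {w | ∃ α, P.IsFeasible ξ (⟨α, w.1, w.2⟩ : Candidate n m p N L)}

/-- Eliminating `α` leaves the range of a linear map in finite dimension, a closed subspace, cut by
closed conditions. -/
theorem isClosed_feasiblePredictions (hU : IsClosed P.U) (hY : IsClosed P.Y)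
    (ξ : ExtState n m p) : IsClosed (P.feasiblePredictions L ξ) := by
  let φ : (Fin (N + 1 - (n + L)) → ℝ) →ₗ[ℝ]
      (Fin (n + L) → Fin m → ℝ) × (Fin (n + L) → Fin p → ℝ) :=
    { toFun := fun α => (fun i a => (hankel (n + L) P.ud *ᵥ α) (i, a),
        fun i b => (hankel (n + L) P.yd *ᵥ α) (i, b))
      map_add' := fun α β => by
        ext <;> simp [Matrix.mulVec_add]
      map_smul' := fun r α => by
        ext <;> simp [Matrix.mulVec_smul] }
  have hset : P.feasiblePredictions L ξ = (LinearMap.range φ : Set _) ∩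
      ({w | ∀ (i : Fin n) (a : Fin m), w.1 (Fin.castAdd L i) a = ξ (Sum.inl (i, a))} ∩
      {w | ∀ (i : Fin n) (b : Fin p), w.2 (Fin.castAdd L i) b = ξ (Sum.inr (i, b))} ∩
      {w | ∀ k : Fin L, w.1 (Fin.natAdd n k) ∈ P.U} ∩
      {w | ∀ k : Fin L, w.2 (Fin.natAdd n k) ∈ P.Y} ∩
      {w | ∀ k : Fin L, L ≤ k.val + n → w.1 (Fin.natAdd n k) = 0} ∩
      {w | ∀ k : Fin L, L ≤ k.val + n → w.2 (Fin.natAdd n k) = 0}) := by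
    ext w
    constructor
    · rintro ⟨α, h⟩
      refine ⟨⟨α, ?_⟩, ⟨⟨⟨⟨⟨h.init_u, h.init_y⟩, h.mem_U⟩, h.mem_Y⟩, h.terminal_u⟩,
        h.terminal_y⟩⟩
      ext i a
      · exact (h.hankel_u (i, a)).symm
      · exact (h.hankel_y (i, a)).symm
    · rintro ⟨⟨α, rfl⟩, ⟨⟨⟨⟨⟨h1, h2⟩, h3⟩, h4⟩, h5⟩, h6⟩⟩
      exact ⟨α, fun _ => rfl, fun _ => rfl, h1, h2, h3, h4, h5, h6⟩
  rw [hset]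
  refine (Submodule.closed_of_finiteDimensional _).inter
    (((((IsClosed.inter ?_ ?_).inter ?_).inter ?_).inter ?_).inter ?_)
  all_goals simp only [Set.ofPred_forall]
  · exact isClosed_iInter fun i => isClosed_iInter fun a =>
      isClosed_eq (by fun_prop) continuous_const
  · exact isClosed_iInter fun i => isClosed_iInter fun a =>
      isClosed_eq (by fun_prop) continuous_const
  · exact isClosed_iInter fun k => hU.preimage (by fun_prop)
  · exact isClosed_iInter fun k => hY.preimage (by fun_prop)
  · exact isClosed_iInter fun k => isClosed_iInter fun _ =>
      isClosed_eq (by fun_prop) continuous_const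
  · exact isClosed_iInter fun k => isClosed_iInter fun _ =>
      isClosed_eq (by fun_prop) continuous_const

/-- The cost does not bound `α`, so compactness is sought for the predictions: the past part is
fixed by `ξ`, and coercivity bounds the rest on a sublevel set. -/
theorem Feasible.exists_isOptimal (hR : P.R.PosDef) (hQ : P.Q.PosDef)
    (hU : IsClosed P.U) (hY : IsClosed P.Y) {ξ : ExtState n m p} (h : P.Feasible L ξ) :
    ∃ z : Candidate n m p N L, P.IsOptimal ξ z := by
  obtain ⟨z₀, hz₀⟩ := h
  obtain ⟨c, hc, hcs⟩ := exists_le_stage hR hQ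
  let f : (Fin (n + L) → Fin m → ℝ) × (Fin (n + L) → Fin p → ℝ) → ℝ :=
    fun w => P.cost (⟨0, w.1, w.2⟩ : Candidate n m p N L)
  have hf : Continuous f := by
    simp only [f, cost, Candidate.uPred, Candidate.yPred, dotProduct, Matrix.mulVec]
    fun_prop
  let K := P.feasiblePredictions L ξ ∩ {w | f w ≤ P.cost z₀}
  have hK : IsCompact K := by
    refine Metric.isCompact_of_isClosed_isBounded
      ((isClosed_feasiblePredictions hU hY ξ).inter (isClosed_le hf continuous_const)) ?_
    refine Metric.isBounded_closedBall.subset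
      (t := Metric.closedBall 0 (‖ξ‖ + √(P.cost z₀ / c))) ?_
    rintro ⟨ub, yb⟩ ⟨⟨α, hw⟩, hle⟩
    have hle' : P.cost (⟨0, ub, yb⟩ : Candidate n m p N L) ≤ P.cost z₀ := hle
    have h1 : (0 : ℝ) ≤ ‖ξ‖ + √(P.cost z₀ / c) := by positivity
    have hpred := fun k : Fin L => norm_le_of_stage_le hc hcs
      ((stage_le_cost hR hQ (⟨0, ub, yb⟩ : Candidate n m p N L) k).trans hle')
    rw [mem_closedBall_zero_iff, Prod.norm_def, max_le_iff, pi_norm_le_iff_of_nonneg h1,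
      pi_norm_le_iff_of_nonneg h1]
    refine ⟨fun i => ?_, fun i => ?_⟩
    · refine Fin.addCases (fun i => ?_) (fun k => ?_) i
      · refine (pi_norm_le_iff_of_nonneg h1).2 fun a => ?_
        have : (ub, yb).1 (Fin.castAdd L i) a = ξ (Sum.inl (i, a)) := hw.init_u i a
        rw [this]
        exact (PiLp.norm_apply_le ξ _).trans (le_add_of_nonneg_right (Real.sqrt_nonneg _))
      · exact (hpred k).1.trans (le_add_of_nonneg_left (norm_nonneg _))
    · refine Fin.addCases (fun i => ?_) (fun k => ?_) i
      · refine (pi_norm_le_iff_of_nonneg h1).2 fun a => ?_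
        have : (ub, yb).2 (Fin.castAdd L i) a = ξ (Sum.inr (i, a)) := hw.init_y i a
        rw [this]
        exact (PiLp.norm_apply_le ξ _).trans (le_add_of_nonneg_right (Real.sqrt_nonneg _))
      · exact (hpred k).2.trans (le_add_of_nonneg_left (norm_nonneg _))
  obtain ⟨w, ⟨⟨α, hw⟩, hw0⟩, hmin⟩ := hK.exists_isMinOn
    ⟨(z₀.ubar, z₀.ybar), ⟨z₀.α, hz₀⟩, le_refl (P.cost z₀)⟩ hf.continuousOn
  refine ⟨⟨α, w.1, w.2⟩, hw, fun z hz => ?_⟩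
  by_cases hzc : P.cost z ≤ P.cost z₀
  · exact hmin (show (z.ubar, z.ybar) ∈ K from ⟨⟨z.α, hz⟩, hzc⟩)
  · exact le_trans hw0 (not_le.1 hzc).le

end Problem
theorem norm_sq_extState {n m p : ℕ} (u : ℤ → Fin m → ℝ) (y : ℤ → Fin p → ℝ) (t : ℤ) :
    ‖extState n u y t‖ ^ 2 = ∑ i ∈ Finset.range n,
      (u (t - n + i) ⬝ᵥ u (t - n + i) + y (t - n + i) ⬝ᵥ y (t - n + i)) := by
  rw [EuclideanSpace.norm_sq_eq, Fintype.sum_sum_type, Fintype.sum_prod_type,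
    Fintype.sum_prod_type, Finset.sum_add_distrib, Finset.sum_range, Finset.sum_range]
  simp [extState, dotProduct, sq]

/-! ### Recursive feasibility -/

section ClosedLoop

variable {n m p N L : ℕ} {S : LTISystem n m p} {P : Problem m p N}

/-- The shifted prediction is feasible at the next time and saves the first stage cost. -/
theorem Problem.IsFeasible.shift (hctrl : S.Controllable) (hobs : S.Observable)
    (hdata : S.IsIOTrajectory P.ud P.yd) (hL : 0 < L) (hnL : n ≤ L)
    (hpe : PersistentlyExciting (L + 2 * n) P.ud) (h0U : 0 ∈ P.U) (h0Y : 0 ∈ P.Y)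
    {x : ℤ → Fin n → ℝ} {u : ℤ → Fin m → ℝ} {y : ℤ → Fin p → ℝ}
    (hsys : ∀ k : ℤ, -(n : ℤ) ≤ k → S.StepAt x u y k) {t : ℕ} {z : Candidate n m p N L}
    (hz : P.IsFeasible (extState n u y t) z) (hut : u t = z.uPred ⟨0, hL⟩) :
    y t = z.yPred ⟨0, hL⟩ ∧ ∃ z' : Candidate n m p N L,
      P.IsFeasible (extState n u y (t + 1 : ℕ)) z' ∧
        P.cost z' + P.stage (u t) (y t) = P.cost z := by
  obtain ⟨xb, hxb⟩ := hdata.hankel_mulVec hz.hankel_u hz.hankel_y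
  -- The default `0` beyond the horizon is the sample appended by the shift.
  let ub : ℕ → Fin m → ℝ := fun k => if h : k < n + L then z.ubar ⟨k, h⟩ else 0
  let yb : ℕ → Fin p → ℝ := fun k => if h : k < n + L then z.ybar ⟨k, h⟩ else 0
  have hub : ∀ k (h : k < n + L), ub k = z.ubar ⟨k, h⟩ := fun k h => dif_pos h
  have hyb : ∀ k (h : k < n + L), yb k = z.ybar ⟨k, h⟩ := fun k h => dif_pos h
  have hub_pred : ∀ k : Fin L, z.uPred k = ub (n + k) := fun k => (hub _ (by omega)).symm
  have hyb_pred : ∀ k : Fin L, z.yPred k = yb (n + k) := fun k => (hyb _ (by omega)).symm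
  have hstep : ∀ k < n + L,
      xb (k + 1) = S.A *ᵥ xb k + S.B *ᵥ ub k ∧ yb k = S.C *ᵥ xb k + S.D *ᵥ ub k := by
    intro k hk
    rw [hub k hk, hyb k hk]
    exact hxb ⟨k, hk⟩
  have hupast : ∀ k < n, ub k = u ((t : ℤ) - n + k) := by
    intro k hk
    rw [hub k (by omega)]
    exact funext fun a => hz.init_u ⟨k, hk⟩ a
  have hypast : ∀ k < n, yb k = y ((t : ℤ) - n + k) := by
    intro k hk
    rw [hyb k (by omega)]
    exact funext fun a => hz.init_y ⟨k, hk⟩ a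
  -- Identifying the predicted state with the plant state is what makes the first predicted output
  -- the measured one.
  have hxt : xb n = x t := by
    have := hobs.state_eq (x := xb) (x' := fun k : ℕ => x ((t : ℤ) - n + k)) (u := ub)
      (u' := fun k : ℕ => u ((t : ℤ) - n + k)) (y := yb)
      (y' := fun k : ℕ => y ((t : ℤ) - n + k))
      (fun k hk => hstep k (by omega)) (fun k hk => ?_) hupast hypast
    · simpa using this
    · have := hsys ((t : ℤ) - n + k) (by omega)
      unfold LTISystem.StepAt at this
      rw [add_assoc] at this
      exact_mod_cast this
  have hut' : u t = ub n := by rw [hut, hub_pred]; rfl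
  have hyt' : y t = yb n := by
    rw [(hsys t (by omega)).2, (hstep n (by omega)).2, hxt, hut']
  have hu_end : ∀ k, L ≤ k → ub k = 0 := by
    intro k hk
    by_cases h : k < n + L
    · have := hz.terminal_u ⟨k - n, by omega⟩ (by simp only; omega)
      rwa [hub_pred, show n + (k - n) = k by omega] at this
    · exact dif_neg h
  have hy_end : ∀ k, L ≤ k → yb k = 0 := by
    intro k hk
    by_cases h : k < n + L
    · have := hz.terminal_y ⟨k - n, by omega⟩ (by simp only; omega)
      rwa [hyb_pred, show n + (k - n) = k by omega] at this
    · exact dif_neg h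
  have hx_end : xb (n + L) = 0 := by
    have := hobs.state_eq (x := fun k => xb (L + k)) (x' := fun _ => 0)
      (u := fun k => ub (L + k)) (u' := fun _ => 0) (y := fun k => yb (L + k)) (y' := fun _ => 0)
      (fun k hk => hstep (L + k) (by omega)) (fun k hk => by simp)
      (fun k _ => hu_end _ (by omega)) (fun k _ => hy_end _ (by omega))
    rwa [add_comm]
  have htraj : S.IsIOTrajectory (fun i : Fin (n + L) => ub (i + 1))
      (fun i : Fin (n + L) => yb (i + 1)) := by
    -- The state reaches `0` at position `n + L` and is kept there; the original `xb` is
    -- unconstrained further on.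
    refine ⟨fun k => if k < n + L then xb (k + 1) else 0, fun k => ?_⟩
    have hk := k.isLt
    simp only [if_pos hk]
    by_cases hk' : k.val + 1 < n + L
    · rw [if_pos hk']
      exact hstep _ hk'
    · rw [if_neg hk', show k.val + 1 = n + L by omega, hx_end, hu_end _ (by omega),
        hy_end _ (by omega)]
      simp
  obtain ⟨α, hαu, hαy⟩ := fundamental_lemma hctrl hdata
    (show PersistentlyExciting (n + L + n) P.ud by
      rwa [show n + L + n = L + 2 * n by omega]) htraj
  refine ⟨by rw [hyt', hyb_pred]; rfl, ⟨α, fun i => ub (i + 1), fun i => yb (i + 1)⟩, ⟨hαu, hαy, ?_, ?_, ?_, ?_, ?_, ?_⟩, ?_⟩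
  · intro i a
    change ub (i.val + 1) a = u (((t + 1 : ℕ) : ℤ) - n + i) a
    by_cases hi : i.val + 1 < n
    · rw [hupast _ hi]
      exact congrArg (fun k => u k a) (by push_cast; ring)
    · have : i.val + 1 = n := by omega
      rw [this, ← hut']
      exact congrArg (fun k => u k a) (by omega)
  · intro i a
    change yb (i.val + 1) a = y (((t + 1 : ℕ) : ℤ) - n + i) a
    by_cases hi : i.val + 1 < n
    · rw [hypast _ hi]
      exact congrArg (fun k => y k a) (by push_cast; ring)
    · have : i.val + 1 = n := by omega
      rw [this, ← hyt']
      exact congrArg (fun k => y k a) (by omega)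
  · intro k
    change ub (n + k + 1) ∈ P.U
    by_cases hk : k.val + 1 < L
    · exact hub_pred ⟨k + 1, hk⟩ ▸ hz.mem_U ⟨k + 1, hk⟩
    · rwa [hu_end _ (by omega)]
  · intro k
    change yb (n + k + 1) ∈ P.Y
    by_cases hk : k.val + 1 < L
    · exact hyb_pred ⟨k + 1, hk⟩ ▸ hz.mem_Y ⟨k + 1, hk⟩
    · rwa [hy_end _ (by omega)]
  · exact fun k hk => hu_end (n + k + 1) (by omega)
  · exact fun k hk => hy_end (n + k + 1) (by omega)
  · rw [Problem.cost_eq, Problem.cost_eq]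
    simp only [hub_pred, hyb_pred]
    change ∑ k : Fin L, P.stage (ub (n + k + 1)) (yb (n + k + 1)) + _ = _
    rw [← Finset.sum_range fun k => P.stage (ub (n + k + 1)) (yb (n + k + 1)),
      ← Finset.sum_range fun k => P.stage (ub (n + k)) (yb (n + k)), hut', hyt']
    -- Splitting `L + 1` stage costs at either end: the last is zero and the first is the saved
    -- cost.
    have h := Finset.sum_range_succ' (fun k => P.stage (ub (n + k)) (yb (n + k))) L
    rw [Finset.sum_range_succ, hu_end (n + L) (by omega), hy_end (n + L) (by omega),
      Problem.stage_zero, add_zero] at h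
    exact h.symm

/-- For `n > 0` the last predicted sample is zero and admissible. For `n = 0` there is no terminal
constraint, but `ξ = 0`, so the bound on the optimal cost forces the optimal prediction to vanish.
-/
theorem Problem.Feasible.zero_mem (hR : P.R.PosDef) (hQ : P.Q.PosDef)
    (hU : IsClosed P.U) (hY : IsClosed P.Y) (hL : 0 < L) {cu : ℝ}
    (hub : ∀ ξ : ExtState n m p, P.Feasible L ξ → P.optCost L ξ ≤ cu * ‖ξ‖ ^ 2)
    {ξ : ExtState n m p} (h : P.Feasible L ξ) : 0 ∈ P.U ∧ 0 ∈ P.Y := by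
  rcases Nat.eq_zero_or_pos n with rfl | hn
  · obtain ⟨z, hz⟩ := h.exists_isOptimal hR hQ hU hY
    have hξ : ξ = 0 := by
      ext i
      rcases i with i | i <;> exact i.1.elim0
    have hle := hub ξ h
    rw [hz.optCost_eq, hξ, norm_zero] at hle
    obtain ⟨c, hc, hcs⟩ := Problem.exists_le_stage hR hQ
    have hn := Problem.norm_le_of_stage_le hc hcs
      ((Problem.stage_le_cost hR hQ z ⟨0, hL⟩).trans hle)
    simp only [ne_eq, OfNat.ofNat_ne_zero, not_false_eq_true, zero_pow, mul_zero, zero_div,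
      Real.sqrt_zero, norm_le_zero_iff] at hn
    exact ⟨hn.1 ▸ hz.1.mem_U ⟨0, hL⟩, hn.2 ▸ hz.1.mem_Y ⟨0, hL⟩⟩
  · obtain ⟨z, hz⟩ := h
    have hlast : L - 1 < L := by omega
    exact ⟨hz.terminal_u ⟨L - 1, hlast⟩ (by simp only; omega) ▸ hz.mem_U ⟨L - 1, hlast⟩,
      hz.terminal_y ⟨L - 1, hlast⟩ (by simp only; omega) ▸ hz.mem_Y ⟨L - 1, hlast⟩⟩

theorem Problem.feasible_zero (h0U : 0 ∈ P.U) (h0Y : 0 ∈ P.Y) :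
    P.Feasible L (0 : ExtState n m p) :=
  ⟨⟨0, 0, 0⟩, by simp, by simp, fun _ _ => rfl, fun _ _ => rfl, fun _ => h0U, fun _ => h0Y,
    fun _ _ => rfl, fun _ _ => rfl⟩

end ClosedLoop

end DDMPC

/-! ### Feasibility, constraint satisfaction and exponential stability -/

theorem mainTheorem3 {n m p N L : ℕ} (S : DDMPC.LTISystem n m p) (P : DDMPC.Problem m p N)
    (hctrl : S.Controllable) (hobs : S.Observable)
    (hdata : S.IsIOTrajectory P.ud P.yd)
    (hR : P.R.PosDef) (hQ : P.Q.PosDef)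
    (hU : IsClosed P.U) (hY : IsClosed P.Y)
    (hL : 0 < L) (hnL : n ≤ L)
    (hpe : DDMPC.PersistentlyExciting (L + 2 * n) P.ud)
    (hub : ∃ cu : ℝ, 0 < cu ∧ ∀ ξ : DDMPC.ExtState n m p,
      P.Feasible L ξ → P.optCost L ξ ≤ cu * ‖ξ‖ ^ 2) :
    (∀ (x : ℤ → Fin n → ℝ) (u : ℤ → Fin m → ℝ) (y : ℤ → Fin p → ℝ),
      DDMPC.IsClosedLoop S P hL x u y →
      P.Feasible L (DDMPC.extState n u y 0) →
        (∀ t : ℕ, P.Feasible L (DDMPC.extState n u y t) ∧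
          ∃ z : DDMPC.Candidate n m p N L, P.IsOptimal (DDMPC.extState n u y t) z) ∧
        (∀ t : ℕ, u t ∈ P.U ∧ y t ∈ P.Y) ∧
        P.Feasible L (0 : DDMPC.ExtState n m p)) ∧
    (∃ M ρ : ℝ, 0 < M ∧ 0 < ρ ∧ ρ < 1 ∧
      ∀ (x : ℤ → Fin n → ℝ) (u : ℤ → Fin m → ℝ) (y : ℤ → Fin p → ℝ),
        DDMPC.IsClosedLoop S P hL x u y →
        P.Feasible L (DDMPC.extState n u y 0) →
        ∀ t : ℕ, ‖DDMPC.extState n u y t‖ ≤ M * ρ ^ t * ‖DDMPC.extState n u y 0‖) := by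
  obtain ⟨cu, hcu, hub⟩ := hub
  have step : ∀ (x : ℤ → Fin n → ℝ) (u : ℤ → Fin m → ℝ) (y : ℤ → Fin p → ℝ),
      DDMPC.IsClosedLoop S P hL x u y → ∀ t : ℕ, P.Feasible L (DDMPC.extState n u y t) →
      ∃ z : DDMPC.Candidate n m p N L, P.IsOptimal (DDMPC.extState n u y t) z ∧
        u t = z.uPred ⟨0, hL⟩ ∧ y t = z.yPred ⟨0, hL⟩ ∧ ∃ z' : DDMPC.Candidate n m p N L,
          P.IsFeasible (DDMPC.extState n u y (t + 1 : ℕ)) z' ∧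
            P.cost z' + P.stage (u t) (y t) = P.cost z := by
    intro x u y hcl t hf
    obtain ⟨h0U, h0Y⟩ := hf.zero_mem hR hQ hU hY hL hub
    obtain ⟨z, hz, hut⟩ := hcl.control t (hf.exists_isOptimal hR hQ hU hY)
    exact ⟨z, hz, hut, hz.1.shift hctrl hobs hdata hL hnL hpe h0U h0Y hcl.system hut⟩
  have feas : ∀ (x : ℤ → Fin n → ℝ) (u : ℤ → Fin m → ℝ) (y : ℤ → Fin p → ℝ),
      DDMPC.IsClosedLoop S P hL x u y → P.Feasible L (DDMPC.extState n u y 0) →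
      ∀ t : ℕ, P.Feasible L (DDMPC.extState n u y t) := by
    intro x u y hcl h0 t
    induction t with
    | zero => exact h0
    | succ t ih =>
      obtain ⟨z, -, -, -, z', hz', -⟩ := step x u y hcl t ih
      exact ⟨z', hz'⟩
  constructor
  · intro x u y hcl h0
    have hf := feas x u y hcl h0
    obtain ⟨h0U, h0Y⟩ := h0.zero_mem hR hQ hU hY hL hub
    refine ⟨fun t => ⟨hf t, (hf t).exists_isOptimal hR hQ hU hY⟩, fun t => ?_,
      DDMPC.Problem.feasible_zero h0U h0Y⟩
    obtain ⟨z, hz, hut, hyt, -⟩ := step x u y hcl t (hf t)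
    rw [hut, hyt]
    exact ⟨hz.1.mem_U _, hz.1.mem_Y _⟩
  · obtain ⟨c, hc, hcs⟩ := DDMPC.Problem.exists_le_stage hR hQ
    obtain ⟨K, θ, hK, hθ, hθ1, hdecay⟩ := DDMPC.exists_exponential_decay n hc hcu
    -- The decay estimate concerns `‖ξ_t‖²`, hence the square roots.
    refine ⟨√K, √θ, Real.sqrt_pos.2 hK, Real.sqrt_pos.2 hθ,
      (Real.sqrt_lt' one_pos).2 (by simpa using hθ1), fun x u y hcl h0 t => ?_⟩
    have hf := feas x u y hcl h0
    have h := hdecay (fun k => u k ⬝ᵥ u k + y k ⬝ᵥ y k)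
      (fun t => P.optCost L (DDMPC.extState n u y t))
      (fun k => add_nonneg (Finset.sum_nonneg fun i _ => mul_self_nonneg _)
        (Finset.sum_nonneg fun i _ => mul_self_nonneg _))
      (fun t => ?_) (fun t => ?_) (fun t => ?_) t
    · rw [← DDMPC.norm_sq_extState, ← DDMPC.norm_sq_extState] at h
      refine le_of_sq_le_sq ?_ (by positivity)
      rw [mul_pow, mul_pow, Real.sq_sqrt hK.le, ← pow_mul, mul_comm t 2, pow_mul,
        Real.sq_sqrt hθ.le]
      exact h
    · obtain ⟨z, hz⟩ := (hf t).exists_isOptimal hR hQ hU hY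
      simp only [hz.optCost_eq]
      exact DDMPC.Problem.cost_nonneg hR hQ z
    -- The shifted candidate bounds the next optimal cost from above.
    · obtain ⟨z, hz, -, -, z', hz', hcost⟩ := step x u y hcl t (hf t)
      obtain ⟨w, hw⟩ := (hf (t + 1)).exists_isOptimal hR hQ hU hY
      simp only [hz.optCost_eq, hw.optCost_eq]
      linarith [hw.2 z' hz', hcs (u t) (y t)]
    · rw [← DDMPC.norm_sq_extState]
      exact hub _ (hf t)
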